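/- Let $L$ be a finite geometric lattice, that is, a finite lattice (with least element $0$ and greatest element $1$) in which every non-zero element is a join of atoms and which is semimodular: whenever $a$ covers $a\wedge b$, the element $a\vee b$ covers $b$. For $x\in L$ let the rank $r(x)$ be the maximum length of a chain $x_0<x_1<\dots<x_n=x$ in $L$ ending at $x$ (such a chain has length $n$), and call $a\in L$ modular if $$r(a\wedge b)+r(a\vee b)=r(a)+r(b)\quad\text{for all } b\in L.$$ Let $\mu_L$ be the Möbius function of $L$, i.e. $\mu_L(x,x)=1$ and $\mu_L(x,y)=-\sum_{x\le z<y}\mu_L(x,z)$ for $x<y$. Let $a$ be a modular element of $L$ with $a\neq 0$ and $a\neq 1$, and let $a^{\perp}=\{x\in L : a\wedge x=0,\ a\vee x=1\}$ be the set of all complements of $a$ in $L$. Then $$\mu_L(0,1)=\mu_L(0,a)\sum_{x\in a^{\perp}}\mu_L(0,x).$$ -/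

import Mathlib

/-- A geometric lattice: a semimodular lattice (if `a` covers `a ⊓ b` then `a ⊔ b` covers `b`)
in which every element is a join of atoms (the bottom element being the empty join).
Finiteness is a separate hypothesis. -/
class IsGeometricLattice (L : Type*) [Lattice L] [BoundedOrder L] : Prop extends
    IsUpperModularLattice L, IsAtomistic L

/-- `a` is a modular element: `r (a ⊓ b) + r (a ⊔ b) = r a + r b` for all `b`, where the rank
`r x = Order.height x` is the maximal length of a chain ending at `x`. -/
def IsModularElement {L : Type*} [Lattice L] (a : L) : Prop :=
  ∀ b : L, Order.height (a ⊓ b) + Order.height (a ⊔ b) = Order.height a + Order.height b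

open Finset

section Height

open Order

variable {α : Type*} [PartialOrder α]

/-! Möbius inversion writes `μ(⊥, ⊤)` as the sum of `μ(⊥, x) μ(⊥, y)` over `x ≤ a`, `a ⊓ y = ⊥`, `x
⊔ y = ⊤` (`mu_bot_eq_sum_filter_sup_eq`, true in any finite lattice). Modularity of `a` and
subadditivity of rank force `x = a`, so `y` runs over the complements of `a`. -/

lemma exists_covBy_height_add_one_eq {x : α} (hx : ¬ IsMin x) (hfin : height x < ⊤) :
    ∃ y, y ⋖ x ∧ height x = height y + 1 := by
  obtain ⟨m, hm⟩ := ENat.ne_top_iff_exists.1 hfin.ne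
  obtain _ | n := m
  · exact absurd (height_eq_zero.1 hm.symm) hx
  have hm' : height x = n + 1 := by rw [← hm]; simp
  obtain ⟨-, ⟨y, hyx, hy⟩, hle⟩ := height_eq_coe_add_one_iff.1 hm'
  refine ⟨y, ⟨hyx, fun z hyz hzx ↦ ?_⟩, by rw [hm', hy]⟩
  have h1 := height_strictMono hyz (by rw [hy]; exact ENat.natCast_lt_top n)
  exact absurd (hle z hzx) (not_le.2 (hy ▸ h1))

lemma exists_covBy_coheight_add_one_eq {x : α} (hx : ¬ IsMax x) (hfin : coheight x < ⊤) :
    ∃ y, x ⋖ y ∧ coheight x = coheight y + 1 := by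
  obtain ⟨y, hy, h⟩ := exists_covBy_height_add_one_eq (α := αᵒᵈ) (x := OrderDual.toDual x)
    (fun h ↦ hx h.ofDual) hfin
  exact ⟨OrderDual.ofDual y, hy.ofDual, h⟩

lemma height_lt_top_of_finite [Finite α] (x : α) : height x < ⊤ := by
  refine lt_of_le_of_lt (height_le fun p _ ↦ ?_) (ENat.natCast_lt_top (Nat.card α))
  have h := Nat.card_le_card_of_injective p p.strictMono.injective
  rw [Nat.card_fin] at h
  exact_mod_cast (Nat.le_succ _).trans h

lemma coheight_lt_top_of_finite [Finite α] (x : α) : coheight x < ⊤ :=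
  height_lt_top_of_finite (OrderDual.toDual x)

end Height

section Semimodular

open Order

variable {L : Type*} [Lattice L] [Finite L]

/-- Jordan–Dedekind argument: let `v` cover `a` on a longest chain; if `v ≠ b`, semimodularity makes
`v ⊔ b` cover both, and induction gives `v` and `b` equal coheight. -/
lemma CovBy.coheight_eq_add_one [IsWeakUpperModularLattice L] {a b : L} (hab : a ⋖ b) :
    coheight a = coheight b + 1 := by
  induction a using WellFoundedGT.induction generalizing b with
  | ind a ih =>
    obtain ⟨v, hav, hv⟩ := exists_covBy_coheight_add_one_eq
      (fun h ↦ h.not_lt hab.lt) (coheight_lt_top_of_finite a)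
    obtain rfl | hne := eq_or_ne v b
    · exact hv
    have hinf : v ⊓ b = a := by
      refine (hav.eq_or_eq (le_inf hav.le hab.le) inf_le_left).resolve_right fun h ↦ ?_
      exact hne ((hab.eq_or_eq hav.le (inf_eq_left.1 h)).resolve_left hav.ne')
    have hv' : v ⋖ v ⊔ b :=
      covBy_sup_of_inf_covBy_of_inf_covBy_left (by rwa [hinf]) (by rwa [hinf])
    have hb' : b ⋖ v ⊔ b :=
      covBy_sup_of_inf_covBy_of_inf_covBy_right (by rwa [hinf]) (by rwa [hinf])
    rw [hv, ih v hav.lt hv', ih b hab.lt hb']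

variable [BoundedOrder L]

lemma height_add_coheight [IsWeakUpperModularLattice L] (x : L) :
    height x + coheight x = coheight (⊥ : L) := by
  induction x using WellFoundedLT.induction with
  | ind x ih =>
    obtain rfl | hx := eq_or_ne x ⊥
    · simp
    obtain ⟨y, hyx, hy⟩ := exists_covBy_height_add_one_eq
      (fun h ↦ hx (isMin_iff_eq_bot.1 h)) (height_lt_top_of_finite x)
    rw [← ih y hyx.lt, hyx.coheight_eq_add_one, hy, add_assoc, add_comm 1]

lemma CovBy.height_eq_add_one [IsWeakUpperModularLattice L] {a b : L} (hab : a ⋖ b) :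
    height b = height a + 1 := by
  have h := (height_add_coheight b).trans (height_add_coheight a).symm
  rw [hab.coheight_eq_add_one, add_comm (coheight b), ← add_assoc] at h
  exact ENat.add_left_injective_of_ne_top (coheight_lt_top_of_finite b).ne h

lemma height_sup_le_add [IsUpperModularLattice L] (x y : L) :
    height (x ⊔ y) ≤ height x + height y := by
  induction x using WellFoundedLT.induction with
  | ind x ih =>
    obtain rfl | hx := eq_or_ne x ⊥
    · simp
    obtain ⟨z, hzx, hz⟩ := exists_covBy_height_add_one_eq
      (fun h ↦ hx (isMin_iff_eq_bot.1 h)) (height_lt_top_of_finite x)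
    have hsup : x ⊔ (z ⊔ y) = x ⊔ y := by rw [← sup_assoc, sup_eq_left.2 hzx.le]
    have hle : height (x ⊔ y) ≤ height (z ⊔ y) + 1 := by
      obtain h | h := hzx.eq_or_eq (le_inf hzx.le (le_sup_left (b := y))) inf_le_left
      · have hcov : z ⊔ y ⋖ x ⊔ (z ⊔ y) := covBy_sup_of_inf_covBy_left (by rwa [h])
        rw [← hsup, hcov.height_eq_add_one]
      · rw [← hsup, sup_eq_right.2 (inf_eq_left.1 h)]
        exact le_self_add
    calc height (x ⊔ y) ≤ height (z ⊔ y) + 1 := hle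
      _ ≤ height z + height y + 1 := by gcongr; exact ih z hzx.lt
      _ = height x + height y := by rw [hz, add_right_comm]

/-- `r a + r y = r ⊤ ≤ r x + r y`, so `x ≤ a` cannot be strict. -/
lemma IsModularElement.eq_of_le_of_sup_eq_top [IsUpperModularLattice L] {a x y : L}
    (ha : IsModularElement a) (hxa : x ≤ a) (hay : a ⊓ y = ⊥) (hxy : x ⊔ y = ⊤) : x = a := by
  have h := ha y
  have htop : a ⊔ y = ⊤ := top_le_iff.1 (hxy ▸ sup_le_sup_right hxa y)
  rw [hay, htop, height_bot, zero_add, ← hxy] at h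
  have hle : height a ≤ height x :=
    (ENat.add_le_add_iff_right (height_lt_top_of_finite y).ne).1 (h ▸ height_sup_le_add x y)
  by_contra hne
  exact hle.not_gt (height_strictMono (hxa.lt_of_ne hne) (height_lt_top_of_finite x))

end Semimodular

section Moebius

open IncidenceAlgebra

variable {L : Type*} [Lattice L] [BoundedOrder L] [Fintype L] [DecidableEq L]
  [LocallyFiniteOrder L]

/-- In any finite lattice, the Möbius function at `z` is the join-convolution of its restrictions
to the elements below `a` and to the elements disjoint from `a`. -/
lemma mu_bot_eq_sum_filter_sup_eq (a z : L) :
    mu ℤ ⊥ z = ∑ p ∈ Icc ⊥ a ×ˢ univ.filter (fun y ↦ a ⊓ y = ⊥) with p.1 ⊔ p.2 = z,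
      mu ℤ ⊥ p.1 * mu ℤ ⊥ p.2 := by
  have key (w : L) : (if w = ⊥ then (1 : ℤ) else 0) = ∑ z ∈ Iic w,
      ∑ p ∈ Icc ⊥ a ×ˢ univ.filter (fun y ↦ a ⊓ y = ⊥) with p.1 ⊔ p.2 = z,
        mu ℤ ⊥ p.1 * mu ℤ ⊥ p.2 := by
    classical
    have hfib : ∑ z ∈ Iic w,
        ∑ p ∈ Icc ⊥ a ×ˢ univ.filter (fun y ↦ a ⊓ y = ⊥) with p.1 ⊔ p.2 = z,
          mu ℤ ⊥ p.1 * mu ℤ ⊥ p.2 =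
        ∑ p ∈ Icc ⊥ (a ⊓ w) ×ˢ univ.filter (fun y ↦ a ⊓ y = ⊥ ∧ y ≤ w),
          mu ℤ ⊥ p.1 * mu ℤ ⊥ p.2 := by
      rw [sum_fiberwise_eq_sum_filter]
      congr 1
      ext p
      simp only [mem_filter, mem_product, mem_Icc, mem_Iic, mem_univ, true_and, bot_le, le_inf_iff,
        sup_le_iff]
      tauto
    rw [hfib, sum_product, ← sum_mul_sum, sum_Icc_mu_right]
    -- The first factor vanishes unless `a ⊓ w = ⊥`; then every `y ≤ w` is disjoint from `a`, and
    -- the second factor is a full sum over `Icc ⊥ w`.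
    by_cases h : ⊥ = a ⊓ w
    · have hset : univ.filter (fun y ↦ a ⊓ y = ⊥ ∧ y ≤ w) = Icc ⊥ w := by
        ext y
        simp only [mem_filter, mem_univ, true_and, mem_Icc, bot_le, and_iff_right_iff_imp]
        exact fun hy ↦ le_bot_iff.1 (h ▸ inf_le_inf_left a hy)
      rw [hset, sum_Icc_mu_right, if_pos h, one_mul]
      simp only [eq_comm]
    · have hw : w ≠ ⊥ := by
        rintro rfl
        simp at h
      rw [if_neg h, if_neg hw, zero_mul]
  rw [moebius_inversion_bot _ _ key z]
  simp

end Moebius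

theorem theorem14p2 {L : Type*} [Lattice L] [BoundedOrder L] [Fintype L] [DecidableEq L]
    [LocallyFiniteOrder L] [IsGeometricLattice L] (a : L) [DecidablePred (IsCompl a)]
    (ha : IsModularElement a) (ha0 : a ≠ ⊥) (ha1 : a ≠ ⊤) :
    IncidenceAlgebra.mu ℤ (⊥ : L) ⊤ =
      IncidenceAlgebra.mu ℤ ⊥ a *
        ∑ x ∈ Finset.univ.filter (fun x : L => IsCompl a x), IncidenceAlgebra.mu ℤ ⊥ x := by
  have hset : (Icc ⊥ a ×ˢ univ.filter (fun y ↦ a ⊓ y = ⊥)).filter (fun p ↦ p.1 ⊔ p.2 = ⊤) =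
      {a} ×ˢ univ.filter (fun x : L => IsCompl a x) := by
    ext ⟨x, y⟩
    simp only [mem_filter, mem_product, mem_Icc, bot_le, true_and, mem_univ, mem_singleton,
      isCompl_iff, disjoint_iff, codisjoint_iff]
    constructor
    · rintro ⟨⟨hxa, hay⟩, hxy⟩
      obtain rfl := ha.eq_of_le_of_sup_eq_top hxa hay hxy
      exact ⟨rfl, hay, hxy⟩
    · rintro ⟨rfl, hay, hxy⟩
      exact ⟨⟨le_rfl, hay⟩, hxy⟩
  rw [mu_bot_eq_sum_filter_sup_eq a ⊤, hset, sum_product, sum_singleton, mul_sum]
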